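/- The diagonals of a convex $n$-gon with vertices labelled clockwise by $1,\dots,n$ are written $(a,b)$ with $1\le a<b\le n$. A \emph{2-triangulation} is a maximal set of diagonals no three of which cross pairwise; the trivial diagonals, i.e. those having fewer than two vertices on one of their sides (they belong to every 2-triangulation and are never part of a pairwise crossing triple), are left out throughout. The diagram of a 2-triangulation $T$ has a cross in row $a$ and column $b$ for each nontrivial diagonal $(a,b)\in T$, and $\deg(v)$ denotes the number of nontrivial diagonals of $T$ ending at the vertex $v$. For a 2-triangulation $T$ of an $n$-gon with $n\ge 6$, the \emph{corner} of $T$ is the largest $r$ with $1\le r\le n-3$ and $(r,r+3)\in T$, and the \emph{parent} $p(T)$ is obtained as follows: delete $(r,r+3)$; delete also $(r-1,r+2)$ if $\deg(r+1)=0$, or $(1,r+1)$ if $\deg(r+2)=0$, or, if both degrees are positive, $(j,r+2)$ with $j=\max\{a: 1\le a<r,\ (a,r+2)\in T\}$; then contract the side $(r+1,r+2)$, i.e. decrease by one every vertex label $v\ge r+2$. For the unique 2-triangulation of the pentagon (which has no nontrivial diagonals) put $r=2$. Label a 2-triangulation $T$ of an $n$-gon by $(h_{r+1},\dots,h_{n-1})$,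 where $r$ is its corner and $h_j$ is the number of crosses in column $j$ of its diagram. \textbf{Proposition.} For $n\ge 6$, the parent of a 2-triangulation of an $n$-gon is a 2-triangulation of an $(n-1)$-gon. The generating tree so defined (root: the 2-triangulation of the pentagon; nodes at level $\ell$: the 2-triangulations of an $(\ell+5)$-gon; edges given by the parent map) is isomorphic, as a rooted labelled tree, to the tree with root labelled $(0,0)$ in which a node labelled $(d_1,\dots,d_s)$ has exactly one child for each label in $$\{(i,\,d_j-i+1,\,d_{j+1}+1,\,d_{j+2},\dots,d_s): 1\le j\le s-1,\ 0\le i\le d_j\}\ \cup\ \{(i,\,d_s-i+1): 0\le i\le d_s+1\}.$$ -/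

import Mathlib

namespace TwoTri

/-! The vertices of a convex `n`-gon are labelled clockwise by `1, …, n`. The segment joining the
vertices `a < b` is encoded by the pair `(a, b)`. -/

/-- The diagonals of the `n`-gon: the pairs `1 ≤ a < b ≤ n` that are not sides. -/
def diagonals (n : ℕ) : Finset (ℕ × ℕ) :=
  (Finset.Icc 1 n ×ˢ Finset.Icc 1 n).filter fun d => d.1 + 2 ≤ d.2 ∧ d ≠ (1, n)

/-- Two diagonals cross if they meet in the interior of the polygon. -/
def Cross (d e : ℕ × ℕ) : Prop :=
  (d.1 < e.1 ∧ e.1 < d.2 ∧ d.2 < e.2) ∨ (e.1 < d.1 ∧ d.1 < e.2 ∧ e.2 < d.2)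

/-- No three diagonals of `S` cross pairwise. -/
def NoThreeCrossing (S : Finset (ℕ × ℕ)) : Prop :=
  ∀ d ∈ S, ∀ e ∈ S, ∀ f ∈ S, ¬ (Cross d e ∧ Cross d f ∧ Cross e f)

/-- `S` is a maximal set of diagonals of the `n`-gon without three pairwise crossing ones (trivial
diagonals included). -/
def IsFullTriangulation (n : ℕ) (S : Finset (ℕ × ℕ)) : Prop :=
  Maximal (fun U => U ⊆ diagonals n ∧ NoThreeCrossing U) S

/-- A diagonal `(a, b)` of the `n`-gon is nontrivial if on each of its two sides there are at least
two vertices. -/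
def Nontriv (n : ℕ) (d : ℕ × ℕ) : Prop :=
  2 ≤ d.2 - d.1 - 1 ∧ 2 ≤ n - (d.2 - d.1) - 1

instance (n : ℕ) (d : ℕ × ℕ) : Decidable (Nontriv n d) := by
  unfold Nontriv; infer_instance

/-- `T` is (the diagram of) a `2`-triangulation of the `n`-gon, the trivial diagonals being
left out. The pairs `(a, b) ∈ T` are the crosses, in row `a` and column `b`. -/
def IsTriangulation (n : ℕ) (T : Finset (ℕ × ℕ)) : Prop :=
  ∃ S, IsFullTriangulation n S ∧ T = S.filter (Nontriv n)

/-- The degree of the vertex `v`: the number of nontrivial diagonals ending at `v`. -/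
def deg (T : Finset (ℕ × ℕ)) (v : ℕ) : ℕ :=
  (T.filter fun d => d.1 = v ∨ d.2 = v).card

/-- The corner of `T`: for `n ≥ 6` the largest `r` with `1 ≤ r ≤ n - 3` and `(r, r + 3) ∈ T`. The
pentagon has no nontrivial diagonals, and by convention the corner is `2` there. -/
def corner (n : ℕ) (T : Finset (ℕ × ℕ)) : ℕ :=
  if n ≤ 5 then 2
  else ((Finset.Icc 1 (n - 3)).filter fun a => (a, a + 3) ∈ T).sup id

/-- The second diagonal that is deleted from `T` (besides `(r, r + 3)`) when its parent is formed,
`r` being the corner. -/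
def secondDeleted (r : ℕ) (T : Finset (ℕ × ℕ)) : ℕ × ℕ :=
  if deg T (r + 1) = 0 then (r - 1, r + 2)
  else if deg T (r + 2) = 0 then (1, r + 1)
  else (((Finset.Ico 1 r).filter fun a => (a, r + 2) ∈ T).sup id, r + 2)

/-- The relabelling of the vertices when the side `(r + 1, r + 2)` is contracted. -/
def contract (r v : ℕ) : ℕ := if r + 2 ≤ v then v - 1 else v

/-- The parent `p(T)` of a `2`-triangulation `T` of the `n`-gon, for `n ≥ 6`. -/
def parent (n : ℕ) (T : Finset (ℕ × ℕ)) : Finset (ℕ × ℕ) :=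
  let r := corner n T
  ((T.erase (r, r + 3)).erase (secondDeleted r T)).image
    fun d => (contract r d.1, contract r d.2)

/-- The number of crosses in column `j` of the diagram `T`. -/
def crossesInColumn (T : Finset (ℕ × ℕ)) (j : ℕ) : ℕ := (T.filter fun d => d.2 = j).card

/-- The list of the numbers of crosses in the columns `r + 1, …, n - 1`, for `r` the corner. -/
def labelOf (n : ℕ) (T : Finset (ℕ × ℕ)) : List ℕ :=
  (List.Ico (corner n T + 1) n).map (crossesInColumn T)

/-- The nodes of the generating tree for `2`-triangulations: at level `ℓ`, the
`2`-triangulations of the `(ℓ + 5)`-gon. -/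
structure TriNode where
  level : ℕ
  diagram : Finset (ℕ × ℕ)
  isTriangulation : IsTriangulation (level + 5) diagram

lemma isTriangulation_pentagon : IsTriangulation 5 ∅ := by
  refine ⟨diagonals 5, ⟨⟨subset_rfl, ?_⟩, fun U hU _ => hU.1⟩, by decide⟩
  unfold NoThreeCrossing Cross
  decide

/-- The root: the `2`-triangulation of the pentagon. -/
def TriNode.root : TriNode := ⟨0, ∅, isTriangulation_pentagon⟩

/-- The label of a node of the generating tree for `2`-triangulations. -/
def TriNode.label (x : TriNode) : List ℕ := labelOf (x.level + 5) x.diagram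

/-- The edges of the generating tree for `2`-triangulations: `x` is the parent of `y`. -/
def TriNode.IsParent (x y : TriNode) : Prop :=
  y.level = x.level + 1 ∧ parent (y.level + 5) y.diagram = x.diagram

/-- The generating rule: `LabelStep d e` says that a node labelled `d` has a child labelled `e`.
In `inner`, `pre` consists of the entries of `d` before `d_j`, and `a = d_j`, `b = d_{j+1}`; in
`last`, `a` is the last entry of `d`. -/
inductive LabelStep : List ℕ → List ℕ → Prop
  | inner (pre : List ℕ) (a b : ℕ) (post : List ℕ) (i : ℕ) (hi : i ≤ a) :
      LabelStep (pre ++ a :: b :: post) (i :: (a - i + 1) :: (b + 1) :: post)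
  | last (pre : List ℕ) (a i : ℕ) (hi : i ≤ a + 1) :
      LabelStep (pre ++ [a]) [i, a + 1 - i]

/-- The nodes of the labelled tree with root `(0, 0)` and the above generating rule. A node is
given by the sequence of the labels met on the way from it up to the root; so a node labelled `d`
has exactly one child for every label that the rule produces from `d`. -/
structure RuleNode where
  path : List (List ℕ)
  ne_nil : path ≠ []
  root_eq : path.getLast ne_nil = [0, 0]
  step : path.IsChain fun e d => LabelStep d e

/-- The root, labelled `(0, 0)`. -/
def RuleNode.root : RuleNode := ⟨[[0, 0]], by simp, by simp, by simp⟩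

/-- The label of a node. -/
def RuleNode.label (x : RuleNode) : List ℕ := x.path.head x.ne_nil

/-- `x` is the parent of `y`. -/
def RuleNode.IsParent (x y : RuleNode) : Prop := y.path = y.label :: x.path

end TwoTri

/-!
Let `S` be a maximal set of diagonals without three pairwise crossing ones, trivial diagonals
included, and let `r` be its corner. Maximality is used in one way throughout: a diagonal that
completes no pairwise crossing triple with two diagonals of `S` lies in `S`. First, every diagonal
of `S` of length at least `3` has one of length exactly `3` below it; applied to the trivial
diagonal `(2, n)` this gives `r ≥ 2`, and it shows that no diagonal of length at least `3` starts
after `r` (`IsFullTriangulation.hasCorner`). Second, there is a `j < r` such that `(j, r + 1)` and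
`(j, r + 2)` both lie in `S`, and `j` separates the crosses of column `r + 1` (in rows `≥ j`)
from those of column `r + 2` (in rows `≤ j`, apart from the trivial diagonal `(r, r + 2)`): this is
`HasCorner.exists_isApex`.

Consequently contracting the side `(r + 1, r + 2)` creates no crossing, and among the diagonals that
are compatible with `j` it destroys none that takes part in a pairwise crossing triple
(`Cross.contractDiag_of_fits`). Maximality therefore passes to the contracted set `merge`, and
conversely from a maximal set of the smaller polygon to the set `splitAt` obtained by splitting the
vertex `r + 1` along a diagonal `(j, r + 1)`. The two operations are inverse to each other. No count
of the diagonals of a `2`-triangulation is needed. The parent map is the contraction: the second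
deleted diagonal is the one that becomes trivial besides `(r, r + 3)`, or one of the two diagonals
with a common image (`HasCorner.parent_eq`).

So the children of a node are indexed by the pairs `(r, j)` with `r` at least the corner of the node
and at most `m - 2`, where `m` is the number of vertices, and `(j, r + 1)` a diagonal, possibly
trivial, with `j < r`. For given `r` the position of `j` among the admissible rows is the first
entry of the label, and the other entries are read off from the columns, which gives the rule;
the last case of the rule has one more child because there the diagonal `(1, r + 1)` is trivial but
admissible (`IsFullTriangulation.card_siteRows`). The label determines `r` through its length and
then `j` through its first entry, so siblings have different labels, and sending a `2`-triangulation
to the sequence of labels on its way to the root is the isomorphism.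
-/

namespace TwoTri

/-! ### Diagonals and crossings -/

lemma mem_diagonals {n a b : ℕ} :
    (a, b) ∈ diagonals n ↔ 1 ≤ a ∧ b ≤ n ∧ a + 2 ≤ b ∧ ¬ (a = 1 ∧ b = n) := by
  simp only [diagonals, Finset.mem_filter, Finset.mem_product, Finset.mem_Icc, ne_eq,
    Prod.mk.injEq]
  omega

lemma Cross.symm {d e : ℕ × ℕ} (h : Cross d e) : Cross e d := by
  unfold Cross at *; omega

lemma not_cross_self (d : ℕ × ℕ) : ¬ Cross d d := by
  unfold Cross; omega

/-- A maximal set contains every diagonal that completes no pairwise crossing triple. -/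
lemma IsFullTriangulation.mem_of_no_crossing {n : ℕ} {S : Finset (ℕ × ℕ)}
    (h : IsFullTriangulation n S) {D : ℕ × ℕ} (hD : D ∈ diagonals n)
    (H : ∀ E ∈ S, ∀ F ∈ S, Cross D E → Cross D F → Cross E F → False) : D ∈ S := by
  refine h.2 (y := insert D S) ⟨Finset.insert_subset hD h.1.1, ?_⟩ (Finset.subset_insert _ _)
    (Finset.mem_insert_self _ _)
  intro d hd e he f hf ⟨h1, h2, h3⟩
  rw [Finset.mem_insert] at hd he hf
  rcases hd with rfl | hd <;> rcases he with rfl | he <;> rcases hf with rfl | hf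
  · exact not_cross_self _ h1
  · exact not_cross_self _ h1
  · exact not_cross_self _ h2
  · exact H e he f hf h1 h2 h3
  · exact not_cross_self _ h3
  · exact H d hd f hf h1.symm h3 h2
  · exact H d hd e he h2.symm h3.symm h1
  · exact h.1.2 d hd e he f hf ⟨h1, h2, h3⟩

lemma isFullTriangulation_of_forall {n : ℕ} {S : Finset (ℕ × ℕ)} (h1 : S ⊆ diagonals n)
    (h2 : NoThreeCrossing S)
    (h3 : ∀ D ∈ diagonals n,
      (∀ E ∈ S, ∀ F ∈ S, Cross D E → Cross D F → Cross E F → False) → D ∈ S) :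
    IsFullTriangulation n S := by
  refine ⟨⟨h1, h2⟩, fun U hU hSU D hD => h3 D (hU.1 hD) fun E hE F hF a b c => ?_⟩
  exact hU.2 D hD E (hSU hE) F (hSU hF) ⟨a, b, c⟩

lemma IsFullTriangulation.bounds {n a b : ℕ} {S : Finset (ℕ × ℕ)}
    (h : IsFullTriangulation n S) (hd : (a, b) ∈ S) :
    1 ≤ a ∧ b ≤ n ∧ a + 2 ≤ b ∧ ¬ (a = 1 ∧ b = n) :=
  mem_diagonals.1 (h.1.1 hd)

/-- Two diagonals crossing a given trivial one share a vertex, so they do not cross. -/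
lemma IsFullTriangulation.mem_of_trivial {n : ℕ} {S : Finset (ℕ × ℕ)}
    (h : IsFullTriangulation n S) {D : ℕ × ℕ} (hD : D ∈ diagonals n) (ht : ¬ Nontriv n D) :
    D ∈ S := by
  refine h.mem_of_no_crossing hD ?_
  obtain ⟨a, b⟩ := D
  rintro ⟨e, e'⟩ hE ⟨f, f'⟩ hF h1 h2 h3
  have := h.bounds hE
  have := h.bounds hF
  rw [mem_diagonals] at hD
  simp only [Nontriv, Cross] at *
  omega

lemma nontriv_iff {n a b : ℕ} (h : (a, b) ∈ diagonals n) :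
    Nontriv n (a, b) ↔ a + 3 ≤ b ∧ b + 3 ≤ n + a := by
  rw [mem_diagonals] at h
  simp only [Nontriv]
  omega

lemma IsFullTriangulation.mem_filter_nontriv {n a b : ℕ} {S : Finset (ℕ × ℕ)}
    (h : IsFullTriangulation n S) :
    (a, b) ∈ S.filter (Nontriv n) ↔ (a, b) ∈ S ∧ a + 3 ≤ b ∧ b + 3 ≤ n + a := by
  rw [Finset.mem_filter]
  constructor
  · rintro ⟨h1, h2⟩
    exact ⟨h1, (nontriv_iff (h.1.1 h1)).1 h2⟩
  · rintro ⟨h1, h2⟩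
    exact ⟨h1, (nontriv_iff (h.1.1 h1)).2 h2⟩

lemma IsFullTriangulation.eq_of_filter_eq {n : ℕ} {S U : Finset (ℕ × ℕ)}
    (hS : IsFullTriangulation n S) (hU : IsFullTriangulation n U)
    (h : S.filter (Nontriv n) = U.filter (Nontriv n)) : S = U := by
  have key : ∀ {S U : Finset (ℕ × ℕ)}, IsFullTriangulation n S → IsFullTriangulation n U →
      S.filter (Nontriv n) = U.filter (Nontriv n) → S ⊆ U := by
    intro S U hS hU h d hd
    by_cases hn : Nontriv n d
    · have : d ∈ U.filter (Nontriv n) := h ▸ Finset.mem_filter.2 ⟨hd, hn⟩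
      exact (Finset.mem_filter.1 this).1
    · exact hU.mem_of_trivial (hS.1.1 hd) hn
  exact (key hS hU h).antisymm (key hU hS h.symm)

/-! ### Short diagonals and the corner -/

/-- A diagonal of length at least `3` has one of length `3` below it: if `(a, b) ∈ S` has length at
least `4` and no `(a, x) ∈ S` with `x < b` has length at least `3`, then `(a + 1, b)` completes no
crossing triple and so lies in `S`. -/
lemma IsFullTriangulation.exists_length_three {n : ℕ} {S : Finset (ℕ × ℕ)}
    (h : IsFullTriangulation n S) :
    ∀ (k a b : ℕ), b ≤ a + k → (a, b) ∈ S → a + 3 ≤ b → ∃ s, a ≤ s ∧ s + 3 ≤ b ∧ (s, s + 3) ∈ S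
  | 0, a, b, hk, _, hab => by omega
  | k + 1, a, b, hk, hS, hab => by
    rcases Nat.lt_or_ge b (a + 4) with hb | hb
    · obtain rfl : b = a + 3 := by omega
      exact ⟨a, le_rfl, le_rfl, hS⟩
    by_cases hx : ∃ x, a + 3 ≤ x ∧ x < b ∧ (a, x) ∈ S
    · obtain ⟨x, h1, h2, h3⟩ := hx
      obtain ⟨s, hs⟩ := h.exists_length_three k a x (by omega) h3 h1
      exact ⟨s, hs.1, by omega, hs.2.2⟩
    · have hS' : (a + 1, b) ∈ S := by
        have := h.bounds hS
        refine h.mem_of_no_crossing (mem_diagonals.2 (by omega)) ?_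
        have aux : ∀ x y, (x, y) ∈ S → Cross (a + 1, b) (x, y) →
            Cross (a, b) (x, y) ∨ x = a ∧ y = a + 2 := by
          intro x y hxy hc
          have h1 := h.bounds hxy
          by_cases hxa : x = a
          · subst hxa
            have h3 : ¬ (x + 3 ≤ y ∧ y < b) := fun h2 => hx ⟨y, h2.1, h2.2, hxy⟩
            dsimp only [Cross] at hc ⊢
            omega
          · left
            simp only [Cross] at *
            omega
        rintro ⟨e, e'⟩ hE ⟨f, f'⟩ hF h1 h2 h3
        rcases aux _ _ hE h1 with h4 | h4 <;> rcases aux _ _ hF h2 with h5 | h5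
        · exact h.1.2 _ hS _ hE _ hF ⟨h4, h5, h3⟩
        all_goals
          simp only [Cross] at *
          omega
      obtain ⟨s, hs⟩ := h.exists_length_three k (a + 1) b (by omega) hS' (by omega)
      exact ⟨s, by omega, hs.2⟩

/-- `r` is the corner of the maximal set `S`: the last row with a diagonal of length `3`. Since
every diagonal of length at least `3` has one of length exactly `3` below it, no row after `r`
contains a diagonal of length at least `3`. -/
structure HasCorner (n r : ℕ) (S : Finset (ℕ × ℕ)) : Prop where
  full : IsFullTriangulation n S
  two_le : 2 ≤ r
  add_three_le : r + 3 ≤ n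
  mem : (r, r + 3) ∈ S
  row_le : ∀ a b, (a, b) ∈ S → a + 3 ≤ b → a ≤ r

lemma HasCorner.corner_eq {n r : ℕ} {S : Finset (ℕ × ℕ)} (h : HasCorner n r S) (hn : 6 ≤ n) :
    corner n (S.filter (Nontriv n)) = r := by
  rw [corner, if_neg (by omega)]
  have h3 := h.add_three_le
  apply le_antisymm
  · refine Finset.sup_le fun a ha => ?_
    simp only [Finset.mem_filter] at ha
    exact h.row_le _ _ ha.2.1 le_rfl
  · refine Finset.le_sup (f := id) (Finset.mem_filter.2 ⟨Finset.mem_Icc.2 ?_, ?_⟩)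
    · have := h.two_le
      omega
    · rw [h.full.mem_filter_nontriv]
      exact ⟨h.mem, le_rfl, by omega⟩

lemma IsFullTriangulation.hasCorner {n : ℕ} {S : Finset (ℕ × ℕ)}
    (h : IsFullTriangulation n S) (hn : 6 ≤ n) :
    HasCorner n (corner n (S.filter (Nontriv n))) S := by
  -- the trivial diagonal `(2, n)` has a diagonal of length `3` below it
  have h2 : (2, n) ∈ S := by
    have hd : (2, n) ∈ diagonals n := mem_diagonals.2 (by omega)
    refine h.mem_of_trivial hd ?_
    rw [nontriv_iff hd]
    omega
  obtain ⟨s, hs1, hs2, hs3⟩ := h.exists_length_three n 2 n (by omega) h2 (by omega)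
  have mem_iff : ∀ a, a ∈ (Finset.Icc 1 (n - 3)).filter
      (fun a => (a, a + 3) ∈ S.filter (Nontriv n)) ↔ (a, a + 3) ∈ S := by
    intro a
    rw [Finset.mem_filter, Finset.mem_Icc, h.mem_filter_nontriv]
    constructor
    · exact fun h => h.2.1
    · intro ha
      have := h.bounds ha
      exact ⟨by omega, ha, by omega, by omega⟩
  have hle : ∀ a, (a, a + 3) ∈ S → a ≤ corner n (S.filter (Nontriv n)) := by
    intro a ha
    rw [corner, if_neg (by omega)]
    exact Finset.le_sup (f := id) ((mem_iff a).2 ha)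
  have hmem : (corner n (S.filter (Nontriv n)), corner n (S.filter (Nontriv n)) + 3) ∈ S := by
    rw [← mem_iff, corner, if_neg (by omega)]
    obtain ⟨x, hx, hx'⟩ := Finset.exists_mem_eq_sup _ ⟨s, (mem_iff s).2 hs3⟩ id
    rw [hx']
    exact hx
  refine ⟨h, hs1.trans (hle s hs3), (h.bounds hmem).2.1, hmem, fun a b hab hlen => ?_⟩
  obtain ⟨t, ht1, -, ht3⟩ := h.exists_length_three (b - a) a b (by omega) hab hlen
  exact ht1.trans (hle t ht3)

/-! ### The star at the corner -/

/-- `j` is the fifth vertex of the star (pentagram) of `S` on the vertices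
`r, r + 1, r + 2, r + 3`: besides `(r, r + 2)`, `(r, r + 3)`, `(r + 1, r + 3)` its edges are
`(j, r + 1)` and `(j, r + 2)`, and `j` separates the crosses of column `r + 1` from those of
column `r + 2`. -/
structure IsApex (r j : ℕ) (S : Finset (ℕ × ℕ)) : Prop where
  lt : j < r
  mem_one : (j, r + 1) ∈ S
  mem_two : (j, r + 2) ∈ S
  le_of_mem : ∀ a, (a, r + 1) ∈ S → j ≤ a
  le_of_mem_two : ∀ a, (a, r + 2) ∈ S → a < r → a ≤ j

lemma HasCorner.exists_isApex {n r : ℕ} {S : Finset (ℕ × ℕ)} (h : HasCorner n r S) :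
    ∃ j, IsApex r j S := by
  have h2 := h.two_le
  have h3 := h.add_three_le
  set B := (Finset.range r).filter fun a => (a, r + 2) ∈ S with hB
  have hBne : B.Nonempty := by
    by_contra hne
    have hno : ∀ a, a < r → (a, r + 2) ∉ S := fun a ha hS =>
      hne ⟨a, by simp [hB, ha, hS]⟩
    rcases Nat.lt_or_ge (r + 3) n with hlt | hge
    · -- a diagonal of `S` crossing `(r + 1, r + 4)` ends at `r + 3` or is `(r, r + 2)`, so no two
      -- such diagonals cross, and `(r + 1, r + 4)` lies in `S` although its row is after `r`
      have hmem : (r + 1, r + 4) ∈ S := by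
        refine h.full.mem_of_no_crossing (mem_diagonals.2 (by omega)) ?_
        rintro ⟨e, e'⟩ hE ⟨f, f'⟩ hF h1 h2 h3
        have := h.full.bounds hE
        have := h.full.bounds hF
        have aux : ∀ x y, (x, y) ∈ S → Cross (r + 1, r + 4) (x, y) →
            x = r ∧ y = r + 2 ∨ y = r + 3 ∧ x ≤ r ∨ x = r + 3 := by
          intro x y hxy hc
          have := h.full.bounds hxy
          have := h.row_le x y hxy
          have : ¬ (x < r ∧ y = r + 2) := fun h4 => hno x h4.1 (h4.2 ▸ hxy)
          simp only [Cross] at *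
          omega
        have := aux _ _ hE h1
        have := aux _ _ hF h2
        simp only [Cross] at *
        omega
      have := h.row_le _ _ hmem (by omega)
      omega
    · -- here `(1, r + 2)` is trivial
      refine hno 1 (by omega) ?_
      have hd : (1, r + 2) ∈ diagonals n := mem_diagonals.2 (by omega)
      refine h.full.mem_of_trivial hd ?_
      rw [nontriv_iff hd]
      omega
  have hmax := B.max'_mem hBne
  have hle := B.le_max'
  set j := B.max' hBne
  simp only [hB, Finset.mem_filter, Finset.mem_range] at hmax hle
  obtain ⟨hj, hj2⟩ := hmax
  have hjb := h.full.bounds hj2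
  have hle' : ∀ a, (a, r + 2) ∈ S → a < r → a ≤ j := fun a ha har => hle a ⟨har, ha⟩
  refine ⟨j, hj, ?_, hj2, ?_, hle'⟩
  · -- as `j` is the largest row, what crosses `(j, r + 1)` also crosses `(j, r + 2)`, except
    -- `(r, r + 2)`, which is crossed only by diagonals at `r + 1`
    refine h.full.mem_of_no_crossing (mem_diagonals.2 (by omega)) ?_
    have aux : ∀ x y, (x, y) ∈ S → Cross (j, r + 1) (x, y) →
        Cross (j, r + 2) (x, y) ∨ x = r ∧ y = r + 2 := by
      intro x y hxy hc
      by_cases hy : y = r + 2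
      · subst hy
        have := hle' x hxy
        dsimp only [Cross] at hc ⊢
        omega
      · left
        have := h.row_le x y hxy
        have := h.full.bounds hxy
        dsimp only [Cross] at hc ⊢
        omega
    rintro ⟨e, e'⟩ hE ⟨f, f'⟩ hF h1 h2 h3
    rcases aux _ _ hE h1 with h4 | h4 <;> rcases aux _ _ hF h2 with h5 | h5
    · exact h.full.1.2 _ hj2 _ hE _ hF ⟨h4, h5, h3⟩
    all_goals
      simp only [Cross] at *
      omega
  · -- otherwise `(a, r + 1)`, `(j, r + 2)`, `(r, r + 3)` cross pairwise
    intro a ha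
    by_contra hlt
    refine h.full.1.2 _ ha _ hj2 _ h.mem ?_
    simp only [Cross]
    omega

/-! ### Contracting a side and splitting a vertex -/

/-- The diagonal obtained from `d` when the side `(r + 1, r + 2)` is contracted. -/
def contractDiag (r : ℕ) (d : ℕ × ℕ) : ℕ × ℕ := (contract r d.1, contract r d.2)

lemma lt_of_contract_lt {r x y : ℕ} (h : contract r x < contract r y) : x < y := by
  unfold contract at h
  split_ifs at h <;> omega

lemma contract_lt {r x y : ℕ} (h : x < y) (h' : ¬ (x = r + 1 ∧ y = r + 2)) :
    contract r x < contract r y := by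
  unfold contract
  split_ifs <;> omega

lemma Cross.of_contractDiag {r : ℕ} {d e : ℕ × ℕ}
    (h : Cross (contractDiag r d) (contractDiag r e)) : Cross d e := by
  simp only [Cross, contractDiag] at *
  rcases h with ⟨h1, h2, h3⟩ | ⟨h1, h2, h3⟩
  · exact .inl ⟨lt_of_contract_lt h1, lt_of_contract_lt h2, lt_of_contract_lt h3⟩
  · exact .inr ⟨lt_of_contract_lt h1, lt_of_contract_lt h2, lt_of_contract_lt h3⟩

/-- The condition on a diagonal `d` at `r + 1` or `r + 2` to fit the star with fifth vertex `j`: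
except for the trivial diagonals `(r, r + 2)` and `(r + 1, r + 3)`, the other end of `d` is at `j`
or on the side of `j` belonging to that vertex. -/
def Fits (r j : ℕ) (d : ℕ × ℕ) : Prop :=
  (d.2 = r + 1 → j ≤ d.1) ∧ (d.2 = r + 2 → d.1 ≤ j ∨ d.1 = r) ∧ (d.1 = r + 1 → d.2 = r + 3)

instance (r j : ℕ) (d : ℕ × ℕ) : Decidable (Fits r j d) := by
  unfold Fits; infer_instance

/-- Contracting `(r + 1, r + 2)` can only undo a crossing between diagonals at `r + 1` and `r + 2`;
two such diagonals that fit the star cross only if one is `(r, r + 2)` or `(r + 1, r + 3)`, and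
then no third diagonal crosses both. -/
lemma Cross.contractDiag_of_fits {r j : ℕ} {d e f : ℕ × ℕ} (hd : Fits r j d)
    (he : Fits r j e) (h1 : Cross d e) (h2 : Cross d f) (h3 : Cross e f) :
    Cross (contractDiag r d) (contractDiag r e) := by
  have key : ∀ {d e f : ℕ × ℕ}, Fits r j d → Fits r j e →
      (d.1 < e.1 ∧ e.1 < d.2 ∧ d.2 < e.2) → Cross d f → Cross e f →
      contract r d.1 < contract r e.1 ∧ contract r e.1 < contract r d.2 ∧
        contract r d.2 < contract r e.2 := by
    intro d e f hd he h1 h2 h3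
    simp only [Fits, Cross] at *
    refine ⟨contract_lt h1.1 ?_, contract_lt h1.2.1 ?_, contract_lt h1.2.2 ?_⟩ <;> omega
  rcases h1 with h1 | h1
  · exact .inl (key hd he h1 h2 h3)
  · exact .inr (key he hd h1 h3 h2)

lemma mem_diagonals_of_cross {m : ℕ} {d e : ℕ × ℕ} (hd : 1 ≤ d.1 ∧ d.2 ≤ m)
    (he : 1 ≤ e.1 ∧ e.2 ≤ m) (h : Cross d e) : d ∈ diagonals m := by
  obtain ⟨a, b⟩ := d
  rw [mem_diagonals]
  simp only [Cross] at *
  omega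

lemma contractDiag_bounds {m r : ℕ} (hr : r + 2 ≤ m) {d : ℕ × ℕ} (h : d ∈ diagonals (m + 1)) :
    1 ≤ (contractDiag r d).1 ∧ (contractDiag r d).2 ≤ m := by
  obtain ⟨a, b⟩ := d
  rw [mem_diagonals] at h
  simp only [contractDiag, contract]
  split_ifs <;> omega

/-- The set obtained from `S` when the side `(r + 1, r + 2)` of the `(m + 1)`-gon is
contracted. -/
def merge (m r : ℕ) (S : Finset (ℕ × ℕ)) : Finset (ℕ × ℕ) :=
  (S.image (contractDiag r)).filter (· ∈ diagonals m)

/-- The set obtained from `S` when the vertex `r + 1` of the `m`-gon is split into `r + 1` and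
`r + 2` along the diagonal `(j, r + 1)`; it contains `(r, r + 3)`, since that is contracted to a
trivial diagonal. -/
def splitAt (m r j : ℕ) (S : Finset (ℕ × ℕ)) : Finset (ℕ × ℕ) :=
  (diagonals (m + 1)).filter fun d =>
    Fits r j d ∧ (contractDiag r d ∈ diagonals m → contractDiag r d ∈ S)

lemma mem_merge {m r : ℕ} {S : Finset (ℕ × ℕ)} {e : ℕ × ℕ} :
    e ∈ merge m r S ↔ e ∈ diagonals m ∧ ∃ d ∈ S, contractDiag r d = e := by
  rw [merge, Finset.mem_filter, Finset.mem_image, and_comm]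

lemma mem_splitAt {m r j : ℕ} {S : Finset (ℕ × ℕ)} {d : ℕ × ℕ} :
    d ∈ splitAt m r j S ↔ d ∈ diagonals (m + 1) ∧ Fits r j d ∧
      (contractDiag r d ∈ diagonals m → contractDiag r d ∈ S) := by
  rw [splitAt, Finset.mem_filter]

lemma HasCorner.fits {n r j : ℕ} {S : Finset (ℕ × ℕ)} (h : HasCorner n r S) (hj : IsApex r j S)
    {d : ℕ × ℕ} (hd : d ∈ S) : Fits r j d := by
  obtain ⟨a, b⟩ := d
  have hb := h.full.bounds hd
  refine ⟨?_, ?_, ?_⟩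
  · rintro rfl
    exact hj.le_of_mem _ hd
  · rintro rfl
    have := hj.le_of_mem_two a hd
    simp only at *
    omega
  · rintro rfl
    have := h.row_le _ _ hd
    simp only at *
    omega

lemma HasCorner.noThreeCrossing_merge {m r : ℕ} {S : Finset (ℕ × ℕ)} (h : HasCorner (m + 1) r S) :
    NoThreeCrossing (merge m r S) := by
  intro d hd e he f hf ⟨h1, h2, h3⟩
  obtain ⟨-, d', hd', rfl⟩ := mem_merge.1 hd
  obtain ⟨-, e', he', rfl⟩ := mem_merge.1 he
  obtain ⟨-, f', hf', rfl⟩ := mem_merge.1 hf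
  exact h.full.1.2 d' hd' e' he' f' hf' ⟨h1.of_contractDiag, h2.of_contractDiag, h3.of_contractDiag⟩

/-- Every diagonal of the `m`-gon is the contraction of one that fits the star. -/
lemma exists_lift {m r : ℕ} (hr : r + 2 ≤ m) (j : ℕ) {e : ℕ × ℕ}
    (he : e ∈ diagonals m) :
    ∃ d ∈ diagonals (m + 1), Fits r j d ∧ contractDiag r d = e := by
  obtain ⟨a, b⟩ := e
  rw [mem_diagonals] at he
  have hc1 : ∀ x, x ≤ r + 1 → contract r x = x := fun x hx => by
    rw [contract, if_neg (by omega)]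
  have hc2 : ∀ x, r + 1 ≤ x → contract r (x + 1) = x := fun x hx => by
    rw [contract, if_pos (by omega), Nat.add_sub_cancel]
  have fin : ∀ x y, (x, y) ∈ diagonals (m + 1) → Fits r j (x, y) → contract r x = a →
      contract r y = b → ∃ d ∈ diagonals (m + 1), Fits r j d ∧ contractDiag r d = (a, b) := by
    intro x y h1 h2 h3 h4
    exact ⟨(x, y), h1, h2, by rw [contractDiag, h3, h4]⟩
  rcases Nat.lt_or_ge b (r + 1) with h1 | h1
  · refine fin a b (mem_diagonals.2 (by omega)) ?_ (hc1 _ (by omega)) (hc1 _ (by omega))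
    simp only [Fits]
    omega
  rcases Nat.lt_or_ge a (r + 1) with h2 | h2
  · by_cases hj : b = r + 1 ∧ j ≤ a
    · refine fin a b (mem_diagonals.2 (by omega)) ?_ (hc1 _ (by omega)) (hc1 _ (by omega))
      simp only [Fits]
      omega
    · refine fin a (b + 1) (mem_diagonals.2 (by omega)) ?_ (hc1 _ (by omega)) (hc2 _ (by omega))
      simp only [Fits]
      omega
  · refine fin (a + 1) (b + 1) (mem_diagonals.2 (by omega)) ?_ (hc2 _ (by omega))
      (hc2 _ (by omega))
    simp only [Fits]
    omega

/-- A pairwise crossing triple of fitting diagonals is contracted to a pairwise crossing triple of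
diagonals of the smaller polygon. -/
lemma contractDiag_triple {m r j : ℕ} (hr : r + 2 ≤ m) {d e f : ℕ × ℕ}
    (hd : d ∈ diagonals (m + 1)) (he : e ∈ diagonals (m + 1)) (hf : f ∈ diagonals (m + 1))
    (hd' : Fits r j d) (he' : Fits r j e) (hf' : Fits r j f)
    (h1 : Cross d e) (h2 : Cross d f) (h3 : Cross e f) :
    (contractDiag r d ∈ diagonals m ∧ contractDiag r e ∈ diagonals m ∧
      contractDiag r f ∈ diagonals m) ∧
    Cross (contractDiag r d) (contractDiag r e) ∧ Cross (contractDiag r d) (contractDiag r f) ∧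
      Cross (contractDiag r e) (contractDiag r f) := by
  have h1' := h1.contractDiag_of_fits hd' he' h2 h3
  have h2' := h2.contractDiag_of_fits hd' hf' h1 h3.symm
  have h3' := h3.contractDiag_of_fits he' hf' h1.symm h2.symm
  have hd := contractDiag_bounds hr hd
  have he := contractDiag_bounds hr he
  have hf := contractDiag_bounds hr hf
  exact ⟨⟨mem_diagonals_of_cross hd he h1', mem_diagonals_of_cross he hf h3',
    mem_diagonals_of_cross hf hd h2'.symm⟩, h1', h2', h3'⟩

lemma HasCorner.isFullTriangulation_merge {m r : ℕ} {S : Finset (ℕ × ℕ)}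
    (h : HasCorner (m + 1) r S) : IsFullTriangulation m (merge m r S) := by
  have hr := h.add_three_le
  obtain ⟨j, hj⟩ := h.exists_isApex
  refine isFullTriangulation_of_forall (fun d hd => (mem_merge.1 hd).1)
    h.noThreeCrossing_merge fun D hD H => ?_
  obtain ⟨d, hd, hd', rfl⟩ := exists_lift (r := r) (by omega) j hD
  refine mem_merge.2 ⟨hD, d, h.full.mem_of_no_crossing hd fun e he f hf h1 h2 h3 => ?_, rfl⟩
  obtain ⟨⟨-, he', hf'⟩, h1, h2, h3⟩ := contractDiag_triple (by omega) hd (h.full.1.1 he)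
    (h.full.1.1 hf) hd' (h.fits hj he) (h.fits hj hf) h1 h2 h3
  exact H _ (mem_merge.2 ⟨he', e, he, rfl⟩) _ (mem_merge.2 ⟨hf', f, hf, rfl⟩) h1 h2 h3

lemma noThreeCrossing_splitAt {m r j : ℕ} {S : Finset (ℕ × ℕ)} (hr : r + 2 ≤ m)
    (h : IsFullTriangulation m S) : NoThreeCrossing (splitAt m r j S) := by
  intro d hd e he f hf ⟨h1, h2, h3⟩
  rw [mem_splitAt] at hd he hf
  obtain ⟨⟨hd', he', hf'⟩, h123⟩ := contractDiag_triple hr hd.1 he.1 hf.1 hd.2.1 he.2.1 hf.2.1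
    h1 h2 h3
  exact h.1.2 _ (hd.2.2 hd') _ (he.2.2 he') _ (hf.2.2 hf') h123

/-- The admissible places where a vertex of the maximal set `S` of diagonals of the `m`-gon can
be split: the vertex `r + 1` lies after the corner, and `(j, r + 1)` is a diagonal of `S`, possibly
trivial. -/
structure IsSite (m r j : ℕ) (S : Finset (ℕ × ℕ)) : Prop where
  full : IsFullTriangulation m S
  two_le : 2 ≤ r
  add_two_le : r + 2 ≤ m
  row_le : ∀ a b, (a, b) ∈ S → a + 3 ≤ b → a ≤ r
  lt : j < r
  mem : (j, r + 1) ∈ S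

lemma contract_of_le {r x : ℕ} (h : x ≤ r + 1) : contract r x = x := by
  rw [contract, if_neg (by omega)]

lemma contract_of_ge {r x : ℕ} (h : r + 2 ≤ x) : contract r x = x - 1 := by
  rw [contract, if_pos h]

lemma HasCorner.isSite {m r j : ℕ} {S : Finset (ℕ × ℕ)} (h : HasCorner (m + 1) r S)
    (hj : IsApex r j S) : IsSite m r j (merge m r S) := by
  have h1 := h.add_three_le
  have h2 := hj.lt
  have h3 := h.full.bounds hj.mem_one
  refine ⟨h.isFullTriangulation_merge, h.two_le, by omega, ?_, hj.lt,
    mem_merge.2 ⟨mem_diagonals.2 (by omega), _, hj.mem_one, ?_⟩⟩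
  · intro a b hab hlen
    obtain ⟨-, ⟨x, y⟩, hd, he⟩ := mem_merge.1 hab
    have := h.row_le x y hd
    simp only [contractDiag, Prod.mk.injEq, contract] at he
    split_ifs at he <;> omega
  · rw [contractDiag, contract_of_le (by simp only; omega), contract_of_le (by simp only; omega)]

lemma IsSite.hasCorner {m r j : ℕ} {S : Finset (ℕ × ℕ)} (h : IsSite m r j S) :
    HasCorner (m + 1) r (splitAt m r j S) := by
  have h1 := h.two_le
  have h2 := h.add_two_le
  have h3 := h.lt
  have h4 := h.full.bounds h.mem
  have hcorner : (r, r + 3) ∈ splitAt m r j S := by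
    have hd : (r, r + 2) ∈ diagonals m := mem_diagonals.2 (by omega)
    refine mem_splitAt.2 ⟨mem_diagonals.2 (by omega), by simp only [Fits]; omega, fun _ => ?_⟩
    rw [contractDiag, contract_of_le (by simp only; omega), contract_of_ge (by simp only; omega)]
    refine h.full.mem_of_trivial (D := (r, r + 2)) hd ?_
    rw [nontriv_iff hd]
    omega
  refine ⟨isFullTriangulation_of_forall (Finset.filter_subset _ _)
    (noThreeCrossing_splitAt h2 h.full) ?_, h1, by omega, hcorner, ?_⟩
  · rintro ⟨a, b⟩ hD H
    have hDb := mem_diagonals.1 hD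
    -- a diagonal that does not fit crosses `(r, r + 3)` and `(j, r + 1)` or `(j, r + 2)`
    have hone : (j, r + 1) ∈ splitAt m r j S := by
      refine mem_splitAt.2 ⟨mem_diagonals.2 (by omega), by simp only [Fits]; omega, fun _ => ?_⟩
      rw [contractDiag, contract_of_le (by simp only; omega), contract_of_le (by simp only; omega)]
      exact h.mem
    have htwo : (j, r + 2) ∈ splitAt m r j S := by
      refine mem_splitAt.2 ⟨mem_diagonals.2 (by omega), by simp only [Fits]; omega, fun _ => ?_⟩
      rw [contractDiag, contract_of_le (by simp only; omega), contract_of_ge (by simp only; omega)]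
      exact h.mem
    have hn1 : ¬ (Cross (a, b) (j, r + 1) ∧ Cross (a, b) (r, r + 3) ∧
        Cross (j, r + 1) (r, r + 3)) :=
      fun h5 => H _ hone _ hcorner h5.1 h5.2.1 h5.2.2
    have hn2 : ¬ (Cross (a, b) (j, r + 2) ∧ Cross (a, b) (r, r + 3) ∧
        Cross (j, r + 2) (r, r + 3)) :=
      fun h5 => H _ htwo _ hcorner h5.1 h5.2.1 h5.2.2
    refine mem_splitAt.2 ⟨hD, ?_, fun hc => ?_⟩
    · dsimp only [Cross, Fits] at hn1 hn2 ⊢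
      omega
    · refine h.full.mem_of_no_crossing hc fun E hE F hF h5 h6 h7 => ?_
      obtain ⟨e, he, he', rfl⟩ := exists_lift h2 j (h.full.1.1 hE)
      obtain ⟨f, hf, hf', rfl⟩ := exists_lift h2 j (h.full.1.1 hF)
      exact H e (mem_splitAt.2 ⟨he, he', fun _ => hE⟩) f (mem_splitAt.2 ⟨hf, hf', fun _ => hF⟩)
        h5.of_contractDiag h6.of_contractDiag h7.of_contractDiag
  · intro a b hab hlen
    obtain ⟨hd, hf, hc⟩ := mem_splitAt.1 hab
    by_contra hra
    rw [mem_diagonals] at hd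
    simp only [Fits] at hf
    rw [contractDiag, contract_of_ge (by simp only; omega), contract_of_ge (by simp only; omega)]
      at hc
    have := h.row_le _ _ (hc (mem_diagonals.2 (by simp only; omega))) (by simp only; omega)
    simp only at this
    omega

lemma IsSite.merge_splitAt {m r j : ℕ} {S : Finset (ℕ × ℕ)} (h : IsSite m r j S) :
    merge m r (splitAt m r j S) = S := by
  ext e
  rw [mem_merge]
  constructor
  · rintro ⟨he, d, hd, rfl⟩
    exact (mem_splitAt.1 hd).2.2 he
  · intro he
    have he' := h.full.1.1 he
    obtain ⟨d, hd, hf, rfl⟩ := exists_lift h.add_two_le j he'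
    exact ⟨he', d, mem_splitAt.2 ⟨hd, hf, fun _ => he⟩, rfl⟩

lemma HasCorner.splitAt_merge {m r j : ℕ} {S : Finset (ℕ × ℕ)} (h : HasCorner (m + 1) r S)
    (hj : IsApex r j S) : splitAt m r j (merge m r S) = S := by
  have hsub : S ⊆ splitAt m r j (merge m r S) := fun d hd =>
    mem_splitAt.2 ⟨h.full.1.1 hd, h.fits hj hd, fun hc => mem_merge.2 ⟨hc, d, hd, rfl⟩⟩
  have hs := (h.isSite hj).hasCorner.full
  exact (h.full.2 hs.1 hsub).antisymm hsub


/-! ### The parent as a contraction -/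

lemma deg_eq_zero_iff {T : Finset (ℕ × ℕ)} {v : ℕ} :
    deg T v = 0 ↔ ∀ a b, (a, b) ∈ T → a ≠ v ∧ b ≠ v := by
  rw [deg, Finset.card_eq_zero, Finset.filter_eq_empty_iff]
  constructor
  · intro h a b hab
    exact not_or.1 (h hab)
  · rintro h ⟨a, b⟩ hab
    exact not_or.2 (h a b hab)

/-- The second deleted diagonal in terms of the star: in the first two cases `(j, r + 1)`,
respectively `(j, r + 2)`, is trivial, and the other of the two diagonals is deleted. -/
lemma HasCorner.secondDeleted_eq {m r j : ℕ} {S : Finset (ℕ × ℕ)} (h : HasCorner (m + 1) r S)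
    (hj : IsApex r j S) :
    secondDeleted r (S.filter (Nontriv (m + 1))) =
      if j + 1 = r then (r - 1, r + 2)
      else if j = 1 ∧ r + 2 = m then (1, r + 1) else (j, r + 2) := by
  have h1 := h.two_le
  have h2 := h.add_three_le
  have h3 := hj.lt
  have h4 := h.full.bounds hj.mem_one
  have deg1 : deg (S.filter (Nontriv (m + 1))) (r + 1) = 0 ↔ j + 1 = r := by
    rw [deg_eq_zero_iff]
    constructor
    · intro H
      by_contra hne
      exact (H j (r + 1) (h.full.mem_filter_nontriv.2 ⟨hj.mem_one, by omega, by omega⟩)).2 rfl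
    · intro hjr a b hab
      rw [h.full.mem_filter_nontriv] at hab
      have hf := h.fits hj hab.1
      simp only [Fits] at hf
      omega
  have deg2 : deg (S.filter (Nontriv (m + 1))) (r + 2) = 0 ↔ j = 1 ∧ r + 2 = m := by
    rw [deg_eq_zero_iff]
    constructor
    · intro H
      by_contra hne
      exact (H j (r + 2) (h.full.mem_filter_nontriv.2 ⟨hj.mem_two, by omega, by omega⟩)).2 rfl
    · intro hjr a b hab
      rw [h.full.mem_filter_nontriv] at hab
      have hf := h.fits hj hab.1
      have := h.row_le a b hab.1
      have := h.full.bounds hab.1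
      simp only [Fits] at hf
      omega
  rw [secondDeleted]
  simp only [deg1, deg2]
  split_ifs with hc1 hc2
  · rfl
  · rfl
  · congr 1
    apply le_antisymm
    · refine Finset.sup_le fun a ha => ?_
      rw [Finset.mem_filter, Finset.mem_Ico, h.full.mem_filter_nontriv] at ha
      exact hj.le_of_mem_two a ha.2.1 ha.1.2
    · refine Finset.le_sup (f := id) (Finset.mem_filter.2 ⟨Finset.mem_Ico.2 ⟨h4.1, h3⟩, ?_⟩)
      rw [h.full.mem_filter_nontriv]
      exact ⟨hj.mem_two, by omega, by omega⟩

/-- The two deleted diagonals are exactly those not needed in the contraction: one becomes trivial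
together with `(r, r + 3)`, or its image is also that of `(j, r + 1)`. -/
lemma HasCorner.parent_eq {m r : ℕ} {S : Finset (ℕ × ℕ)} (h : HasCorner (m + 1) r S)
    (hm : 5 ≤ m) :
    parent (m + 1) (S.filter (Nontriv (m + 1))) = (merge m r S).filter (Nontriv m) := by
  obtain ⟨j, hj⟩ := h.exists_isApex
  have h1 := h.two_le
  have h2 := h.add_three_le
  have h3 := hj.lt
  have h4 := h.full.bounds hj.mem_one
  have hfull := h.isFullTriangulation_merge
  have hdel := h.secondDeleted_eq hj
  rw [parent, h.corner_eq (by omega)]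
  simp only [hdel]
  ext ⟨x, y⟩
  rw [hfull.mem_filter_nontriv, mem_merge, mem_diagonals, Finset.mem_image]
  simp only [Prod.exists, Finset.mem_erase, h.full.mem_filter_nontriv, contractDiag,
    Prod.mk.injEq]
  constructor
  · rintro ⟨a, b, ⟨hne2, hne1, hab, hlen⟩, hx, hy⟩
    have hb := h.full.bounds hab
    have hrow := h.row_le a b hab
    have hf := h.fits hj hab
    simp only [Fits] at hf
    have key : x + 3 ≤ y ∧ y + 3 ≤ m + x ∧ 1 ≤ x ∧ y ≤ m := by
      unfold contract at hx hy
      split_ifs at hne2 <;> simp only [ne_eq, Prod.mk.injEq] at hne1 hne2 <;>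
        split_ifs at hx hy <;> omega
    exact ⟨⟨by omega, a, b, hab, hx, hy⟩, by omega, by omega⟩
  · rintro ⟨⟨hxy, a, b, hab, hx, hy⟩, hlen⟩
    have hb := h.full.bounds hab
    have hrow := h.row_le a b hab
    by_cases hc : a = j ∧ b = r + 2
    · obtain ⟨rfl, rfl⟩ := hc
      rw [contract_of_le (by omega)] at hx
      rw [contract_of_ge (by omega)] at hy
      refine ⟨a, r + 1, ⟨?_, ?_, hj.mem_one, ?_, ?_⟩, ?_, ?_⟩
      · split_ifs <;> simp only [ne_eq, Prod.mk.injEq] <;> omega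
      · simp only [ne_eq, Prod.mk.injEq]
        omega
      · omega
      · omega
      · rw [contract_of_le (by omega), hx]
      · rw [contract_of_le (by omega)]
        omega
    · refine ⟨a, b, ⟨?_, ?_, hab, ?_, ?_⟩, hx, hy⟩
      all_goals unfold contract at hx hy
      · split_ifs <;> simp only [ne_eq, Prod.mk.injEq] <;> split_ifs at hx hy <;> omega
      · simp only [ne_eq, Prod.mk.injEq]
        split_ifs at hx hy <;> omega
      · split_ifs at hx hy <;> omega
      · split_ifs at hx hy <;> omega

lemma IsSite.parent_splitAt {m r j : ℕ} {S : Finset (ℕ × ℕ)} (h : IsSite m r j S) (hm : 5 ≤ m) :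
    parent (m + 1) ((splitAt m r j S).filter (Nontriv (m + 1))) = S.filter (Nontriv m) := by
  rw [h.hasCorner.parent_eq hm, h.merge_splitAt]

/-! ### The columns of a diagram after a splitting -/

lemma IsFullTriangulation.crossesInColumn_eq {n : ℕ} {S : Finset (ℕ × ℕ)}
    (h : IsFullTriangulation n S) (k : ℕ) :
    crossesInColumn (S.filter (Nontriv n)) k =
      ((Finset.range k).filter fun a => (a, k) ∈ S ∧ a + 3 ≤ k ∧ k + 3 ≤ n + a).card := by
  rw [crossesInColumn]
  refine (Finset.card_bij (fun a _ => (a, k)) ?_ ?_ ?_).symm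
  · intro a ha
    rw [Finset.mem_filter] at ha
    exact Finset.mem_filter.2 ⟨h.mem_filter_nontriv.2 ha.2, rfl⟩
  · intro a _ b _ hab
    exact congrArg Prod.fst hab
  · rintro ⟨a, b⟩ hab
    obtain ⟨h1, h2⟩ := Finset.mem_filter.1 hab
    simp only at h2
    subst h2
    rw [h.mem_filter_nontriv] at h1
    exact ⟨a, Finset.mem_filter.2 ⟨Finset.mem_range.2 (by omega), h1⟩, rfl⟩

/-- The vertices `a < r` joined to `r + 1`; they are the possible positions `j` of a splitting of
the vertex `r + 1`. -/
def siteRows (r : ℕ) (S : Finset (ℕ × ℕ)) : Finset ℕ :=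
  (Finset.range r).filter fun a => (a, r + 1) ∈ S

lemma mem_siteRows {r a : ℕ} {S : Finset (ℕ × ℕ)} :
    a ∈ siteRows r S ↔ a < r ∧ (a, r + 1) ∈ S := by
  rw [siteRows, Finset.mem_filter, Finset.mem_range]

lemma IsFullTriangulation.sub_one_mem_siteRows {m r : ℕ} {S : Finset (ℕ × ℕ)}
    (h : IsFullTriangulation m S) (h1 : 2 ≤ r) (h2 : r + 2 ≤ m) : r - 1 ∈ siteRows r S := by
  have hd : (r - 1, r + 1) ∈ diagonals m := mem_diagonals.2 (by omega)
  refine mem_siteRows.2 ⟨by omega, h.mem_of_trivial hd ?_⟩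
  rw [nontriv_iff hd]
  omega

/-- Besides the crosses of column `r + 1`, the trivial diagonal `(r - 1, r + 1)` counts and, when
`r + 1` is the last vertex but one, so does `(1, r + 1)`. -/
lemma IsFullTriangulation.card_siteRows {m r : ℕ} {S : Finset (ℕ × ℕ)}
    (h : IsFullTriangulation m S) (hm : 5 ≤ m) (h1 : 2 ≤ r) (h2 : r + 2 ≤ m) :
    (siteRows r S).card = crossesInColumn (S.filter (Nontriv m)) (r + 1) + 1 +
      if r + 2 = m then 1 else 0 := by
  rw [h.crossesInColumn_eq]
  set C := (Finset.range (r + 1)).filter fun a => (a, r + 1) ∈ S ∧ a + 3 ≤ r + 1 ∧ r + 1 + 3 ≤ m + a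
    with hC
  have hsub := h.sub_one_mem_siteRows h1 h2
  have hr1 : r - 1 ∉ C := by
    rw [hC, Finset.mem_filter]
    omega
  split_ifs with hlast
  · have hone : (1, r + 1) ∈ S := by
      have hd : (1, r + 1) ∈ diagonals m := mem_diagonals.2 (by omega)
      refine h.mem_of_trivial hd ?_
      rw [nontriv_iff hd]
      omega
    have : siteRows r S = insert 1 (insert (r - 1) C) := by
      ext a
      rw [Finset.mem_insert, Finset.mem_insert, mem_siteRows, hC, Finset.mem_filter,
        Finset.mem_range]
      constructor
      · rintro ⟨ha, haS⟩
        have := h.bounds haS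
        by_cases ha1 : a = 1
        · exact .inl ha1
        by_cases ha2 : a = r - 1
        · exact .inr (.inl ha2)
        exact .inr (.inr ⟨by omega, haS, by omega, by omega⟩)
      · rintro (rfl | rfl | ha)
        · exact ⟨by omega, hone⟩
        · exact mem_siteRows.1 hsub
        · exact ⟨by omega, ha.2.1⟩
    rw [this, Finset.card_insert_of_notMem, Finset.card_insert_of_notMem hr1]
    rw [Finset.mem_insert, hC, Finset.mem_filter]
    omega
  · have : siteRows r S = insert (r - 1) C := by
      ext a
      rw [Finset.mem_insert, mem_siteRows, hC, Finset.mem_filter, Finset.mem_range]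
      constructor
      · rintro ⟨ha, haS⟩
        have := h.bounds haS
        by_cases ha2 : a = r - 1
        · exact .inl ha2
        exact .inr ⟨by omega, haS, by omega, by omega⟩
      · rintro (rfl | ha)
        · exact mem_siteRows.1 hsub
        · exact ⟨by omega, ha.2.1⟩
    rw [this, Finset.card_insert_of_notMem hr1, add_zero]

lemma card_filter_le_add_card_filter_lt (A : Finset ℕ) (j : ℕ) :
    (A.filter (· ≤ j)).card + (A.filter (j < ·)).card = A.card := by
  rw [← Finset.card_filter_add_card_filter_not (s := A) (· ≤ j)]
  simp only [not_le]

lemma card_filter_lt_lt {A : Finset ℕ} {j k : ℕ} (hk : k ∈ A) (h : j < k) :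
    (A.filter (k < ·)).card < (A.filter (j < ·)).card := by
  refine Finset.card_lt_card (Finset.ssubset_iff_of_subset ?_ |>.2 ⟨k, ?_, ?_⟩)
  · intro a ha
    rw [Finset.mem_filter] at *
    exact ⟨ha.1, h.trans ha.2⟩
  · exact Finset.mem_filter.2 ⟨hk, h⟩
  · simp

lemma card_filter_lt_injOn (A : Finset ℕ) :
    Set.InjOn (fun j => (A.filter (j < ·)).card) (A : Set ℕ) := by
  intro j hj k hk hjk
  rcases lt_trichotomy j k with h | h | h
  · exact absurd hjk (card_filter_lt_lt hk h).ne'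
  · exact h
  · exact absurd hjk (card_filter_lt_lt hj h).ne

lemma exists_card_filter_lt_eq (A : Finset ℕ) {i : ℕ} (hi : i < A.card) :
    ∃ j ∈ A, (A.filter (j < ·)).card = i := by
  have himage : A.image (fun j => (A.filter (j < ·)).card) = Finset.range A.card := by
    refine Finset.eq_of_subset_of_card_le ?_ ?_
    · intro x hx
      obtain ⟨j, hj, rfl⟩ := Finset.mem_image.1 hx
      rw [Finset.mem_range]
      exact Finset.card_lt_card (Finset.filter_ssubset.2 ⟨j, hj, lt_irrefl j⟩)
    · rw [Finset.card_range, Finset.card_image_of_injOn (card_filter_lt_injOn A)]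
  exact Finset.mem_image.1 (himage ▸ Finset.mem_range.2 hi)

/-- After the splitting, column `r + 1` has the crosses in rows `j, …, r - 2`, that is, as many as
there are rows after `j` when the trivial diagonal in row `r - 1` is counted. -/
lemma IsSite.crossesInColumn_one {m r j : ℕ} {S : Finset (ℕ × ℕ)} (h : IsSite m r j S) :
    crossesInColumn ((splitAt m r j S).filter (Nontriv (m + 1))) (r + 1) =
      ((siteRows r S).filter (j < ·)).card := by
  have h1 := h.two_le
  have h2 := h.add_two_le
  have h3 := h.lt
  have hsub := h.full.sub_one_mem_siteRows h1 h2
  rw [h.hasCorner.full.crossesInColumn_eq]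
  have hjmem : j ∈ siteRows r S := mem_siteRows.2 ⟨h3, h.mem⟩
  set C := (Finset.range (r + 1)).filter fun a => (a, r + 1) ∈ splitAt m r j S ∧
    a + 3 ≤ r + 1 ∧ r + 1 + 3 ≤ m + 1 + a with hC
  have hcol : ∀ a, a < r → ((a, r + 1) ∈ splitAt m r j S ↔ (a, r + 1) ∈ S ∧ j ≤ a) := by
    intro a ha
    have hc : contractDiag r (a, r + 1) = (a, r + 1) := by
      rw [contractDiag, contract_of_le (by simp only; omega), contract_of_le (by simp only; omega)]
    rw [mem_splitAt, hc]
    constructor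
    · rintro ⟨hd, hf, hS⟩
      rw [mem_diagonals] at hd
      exact ⟨hS (mem_diagonals.2 (by omega)), hf.1 rfl⟩
    · rintro ⟨hS, hja⟩
      have := h.full.bounds hS
      exact ⟨mem_diagonals.2 (by omega), by simp only [Fits]; omega, fun _ => hS⟩
  have e1 : insert (r - 1) C = insert j ((siteRows r S).filter (j < ·)) := by
    ext a
    rw [Finset.mem_insert, Finset.mem_insert, hC, Finset.mem_filter, Finset.mem_filter,
      Finset.mem_range]
    constructor
    · rintro (rfl | ⟨-, haS, ha⟩)
      · by_cases hj : r - 1 = j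
        · exact .inl hj
        · exact .inr ⟨hsub, by omega⟩
      · rw [hcol a (by omega)] at haS
        by_cases hj : a = j
        · exact .inl hj
        · exact .inr ⟨mem_siteRows.2 ⟨by omega, haS.1⟩, by omega⟩
    · have key : a ∈ siteRows r S → j ≤ a → a = r - 1 ∨ a < r + 1 ∧
          (a, r + 1) ∈ splitAt m r j S ∧ a + 3 ≤ r + 1 ∧ r + 1 + 3 ≤ m + 1 + a := by
        intro ha hja
        rw [mem_siteRows] at ha
        have := h.full.bounds ha.2
        by_cases har : a = r - 1
        · exact .inl har
        · exact .inr ⟨by omega, (hcol a ha.1).2 ⟨ha.2, hja⟩, by omega, by omega⟩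
      rintro (rfl | ⟨ha, hja⟩)
      · exact key hjmem le_rfl
      · exact key ha hja.le
  have e2 := congrArg Finset.card e1
  rw [Finset.card_insert_of_notMem, Finset.card_insert_of_notMem] at e2
  · omega
  · simp
  · rw [hC, Finset.mem_filter]
    omega

lemma IsSite.crossesInColumn_two {m r j : ℕ} {S : Finset (ℕ × ℕ)} (h : IsSite m r j S) :
    crossesInColumn ((splitAt m r j S).filter (Nontriv (m + 1))) (r + 2) +
      (if r + 2 = m then 1 else 0) = ((siteRows r S).filter (· ≤ j)).card := by
  have h1 := h.two_le
  have h2 := h.add_two_le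
  have h3 := h.lt
  have h4 := h.full.bounds h.mem
  rw [h.hasCorner.full.crossesInColumn_eq]
  set C := (Finset.range (r + 2)).filter fun a => (a, r + 2) ∈ splitAt m r j S ∧
    a + 3 ≤ r + 2 ∧ r + 2 + 3 ≤ m + 1 + a with hC
  have hcol : ∀ a, a < r → ((a, r + 2) ∈ splitAt m r j S ↔ (a, r + 1) ∈ S ∧ a ≤ j) := by
    intro a ha
    have hc : contractDiag r (a, r + 2) = (a, r + 1) := by
      rw [contractDiag, contract_of_le (by simp only; omega), contract_of_ge (by simp only; omega)]
      rfl
    rw [mem_splitAt, hc]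
    constructor
    · rintro ⟨hd, hf, hS⟩
      rw [mem_diagonals] at hd
      have := hf.2.1 rfl
      simp only at this
      exact ⟨hS (mem_diagonals.2 (by omega)), by omega⟩
    · rintro ⟨hS, hja⟩
      have := h.full.bounds hS
      exact ⟨mem_diagonals.2 (by omega), by simp only [Fits]; omega, fun _ => hS⟩
  have mem_C : ∀ a, a ∈ C ↔ a ∈ (siteRows r S).filter (· ≤ j) ∧ r + 4 ≤ m + a := by
    intro a
    rw [hC, Finset.mem_filter, Finset.mem_filter, Finset.mem_range, mem_siteRows]
    constructor
    · rintro ⟨-, haS, ha⟩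
      rw [hcol a (by omega)] at haS
      exact ⟨⟨⟨by omega, haS.1⟩, haS.2⟩, by omega⟩
    · rintro ⟨⟨⟨har, haS⟩, haj⟩, ham⟩
      exact ⟨by omega, (hcol a har).2 ⟨haS, haj⟩, by omega, by omega⟩
  split_ifs with hlast
  · have hd : (1, r + 1) ∈ diagonals m := mem_diagonals.2 (by omega)
    have hone : (1, r + 1) ∈ S := by
      refine h.full.mem_of_trivial hd ?_
      rw [nontriv_iff hd]
      omega
    have hnot : 1 ∉ C := by
      rw [mem_C]
      omega
    rw [← Finset.card_insert_of_notMem hnot]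
    congr 1
    ext a
    rw [Finset.mem_insert, mem_C]
    constructor
    · rintro (rfl | ha)
      · exact Finset.mem_filter.2 ⟨mem_siteRows.2 ⟨by omega, hone⟩, h4.1⟩
      · exact ha.1
    · intro ha
      have := h.full.bounds (mem_siteRows.1 (Finset.mem_filter.1 ha).1).2
      by_cases ha1 : a = 1
      · exact .inl ha1
      · exact .inr ⟨ha, by omega⟩
  · rw [add_zero]
    congr 1
    ext a
    rw [mem_C]
    constructor
    · exact fun ha => ha.1
    · intro ha
      have := h.full.bounds (mem_siteRows.1 (Finset.mem_filter.1 ha).1).2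
      exact ⟨ha, by omega⟩

/-- Columns from `r + 3` on are those of `S` shifted by one, apart from the new cross
`(r, r + 3)`. -/
lemma IsSite.mem_splitAt_iff {m r j a k : ℕ} {S : Finset (ℕ × ℕ)} (h : IsSite m r j S)
    (hk : r + 2 ≤ k) (ha : a ≤ r) (hak : a + 3 ≤ k) (ham : k + 2 ≤ m + a) :
    (a, k + 1) ∈ splitAt m r j S ↔ (a, k) ∈ S := by
  have h1 := h.two_le
  have hc : contractDiag r (a, k + 1) = (a, k) := by
    rw [contractDiag, contract_of_le (by simp only; omega), contract_of_ge (by simp only; omega)]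
    rfl
  rw [mem_splitAt, hc]
  constructor
  · rintro ⟨hd, hf, hS⟩
    rw [mem_diagonals] at hd
    exact hS (mem_diagonals.2 (by omega))
  · intro hS
    have := h.full.bounds hS
    exact ⟨mem_diagonals.2 (by omega), by simp only [Fits]; omega, fun _ => hS⟩

lemma IsSite.crossesInColumn_three {m r j : ℕ} {S : Finset (ℕ × ℕ)} (h : IsSite m r j S)
    (hm : 5 ≤ m) :
    crossesInColumn ((splitAt m r j S).filter (Nontriv (m + 1))) (r + 3) =
      crossesInColumn (S.filter (Nontriv m)) (r + 2) + 1 := by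
  have h1 := h.two_le
  have h2 := h.add_two_le
  have hcor := h.hasCorner
  rw [hcor.full.crossesInColumn_eq, h.full.crossesInColumn_eq]
  rw [← Finset.card_insert_of_notMem (a := r)]
  · congr 1
    ext a
    simp only [Finset.mem_insert, Finset.mem_filter, Finset.mem_range]
    constructor
    · rintro ⟨-, haS, ha⟩
      by_cases har : a = r
      · exact .inl har
      · exact .inr ⟨by omega, (h.mem_splitAt_iff le_rfl (by omega) (by omega) (by omega)).1 haS,
          by omega, by omega⟩
    · rintro (rfl | ⟨-, haS, ha⟩)
      · exact ⟨by omega, hcor.mem, by omega, by omega⟩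
      · exact ⟨by omega, (h.mem_splitAt_iff le_rfl (by omega) (by omega) (by omega)).2 haS,
          by omega, by omega⟩
  · rw [Finset.mem_filter]
    omega

lemma IsSite.crossesInColumn_succ {m r j k : ℕ} {S : Finset (ℕ × ℕ)} (h : IsSite m r j S)
    (hk : r + 3 ≤ k) :
    crossesInColumn ((splitAt m r j S).filter (Nontriv (m + 1))) (k + 1) =
      crossesInColumn (S.filter (Nontriv m)) k := by
  have hcor := h.hasCorner
  rw [hcor.full.crossesInColumn_eq, h.full.crossesInColumn_eq]
  congr 1
  ext a
  simp only [Finset.mem_filter, Finset.mem_range]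
  constructor
  · rintro ⟨-, haS, ha⟩
    have := hcor.row_le _ _ haS (by omega)
    exact ⟨by omega, (h.mem_splitAt_iff (by omega) this (by omega) (by omega)).1 haS,
      by omega, by omega⟩
  · rintro ⟨-, haS, ha⟩
    have := h.row_le _ _ haS (by omega)
    exact ⟨by omega, (h.mem_splitAt_iff (by omega) this (by omega) (by omega)).2 haS,
      by omega, by omega⟩

/-! ### The labels of the children -/

lemma IsFullTriangulation.two_le_corner {m : ℕ} {S : Finset (ℕ × ℕ)}
    (h : IsFullTriangulation m S) : 2 ≤ corner m (S.filter (Nontriv m)) := by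
  rcases Nat.lt_or_ge m 6 with h6 | h6
  · rw [corner, if_pos (by omega)]
  · exact (h.hasCorner h6).two_le

lemma IsFullTriangulation.row_le_corner {m : ℕ} {S : Finset (ℕ × ℕ)}
    (h : IsFullTriangulation m S) {a b : ℕ} (hab : (a, b) ∈ S) (hlen : a + 3 ≤ b) :
    a ≤ corner m (S.filter (Nontriv m)) := by
  rcases Nat.lt_or_ge m 6 with h6 | h6
  · rw [corner, if_pos (by omega)]
    have := h.bounds hab
    omega
  · exact (h.hasCorner h6).row_le a b hab hlen

lemma IsSite.corner_le {m r j : ℕ} {S : Finset (ℕ × ℕ)} (h : IsSite m r j S) :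
    corner m (S.filter (Nontriv m)) ≤ r := by
  rcases Nat.lt_or_ge m 6 with h6 | h6
  · rw [corner, if_pos (by omega)]
    exact h.two_le
  · exact h.row_le _ _ (h.full.hasCorner h6).mem le_rfl

lemma IsSite.corner_splitAt {m r j : ℕ} {S : Finset (ℕ × ℕ)} (h : IsSite m r j S)
    (hm : 5 ≤ m) : corner (m + 1) ((splitAt m r j S).filter (Nontriv (m + 1))) = r :=
  h.hasCorner.corner_eq (by omega)

lemma IsSite.labelOf_splitAt_last {m r j : ℕ} {S : Finset (ℕ × ℕ)} (h : IsSite m r j S)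
    (hm : 5 ≤ m) (hr : r + 2 = m) :
    labelOf (m + 1) ((splitAt m r j S).filter (Nontriv (m + 1))) =
      [((siteRows r S).filter (j < ·)).card, crossesInColumn (S.filter (Nontriv m)) (r + 1) + 1 -
        ((siteRows r S).filter (j < ·)).card] := by
  have c1 := h.crossesInColumn_one
  have c2 := h.crossesInColumn_two
  have c3 := h.full.card_siteRows hm h.two_le h.add_two_le
  have c4 := card_filter_le_add_card_filter_lt (siteRows r S) j
  rw [if_pos hr] at c2 c3
  rw [labelOf, h.corner_splitAt hm, List.Ico.eq_cons (by omega), List.Ico.eq_cons (by omega),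
    List.Ico.eq_nil_of_le (by omega)]
  simp only [List.map_cons, List.map_nil, List.cons.injEq, and_true, add_assoc, Nat.reduceAdd]
  exact ⟨c1, by omega⟩

lemma IsSite.labelOf_splitAt_inner {m r j : ℕ} {S : Finset (ℕ × ℕ)} (h : IsSite m r j S)
    (hm : 5 ≤ m) (hr : r + 2 < m) :
    labelOf (m + 1) ((splitAt m r j S).filter (Nontriv (m + 1))) =
      ((siteRows r S).filter (j < ·)).card ::
      (crossesInColumn (S.filter (Nontriv m)) (r + 1) -
        ((siteRows r S).filter (j < ·)).card + 1) ::
      (crossesInColumn (S.filter (Nontriv m)) (r + 2) + 1) ::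
      (List.Ico (r + 3) m).map (crossesInColumn (S.filter (Nontriv m))) := by
  have c1 := h.crossesInColumn_one
  have c2 := h.crossesInColumn_two
  have c3 := h.full.card_siteRows hm h.two_le h.add_two_le
  have c4 := card_filter_le_add_card_filter_lt (siteRows r S) j
  have c5 : 0 < ((siteRows r S).filter (· ≤ j)).card :=
    Finset.card_pos.2 ⟨j, Finset.mem_filter.2 ⟨mem_siteRows.2 ⟨h.lt, h.mem⟩, le_rfl⟩⟩
  rw [if_neg hr.ne] at c2 c3
  rw [labelOf, h.corner_splitAt hm, List.Ico.eq_cons (by omega), List.Ico.eq_cons (by omega),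
    List.Ico.eq_cons (by omega)]
  simp only [List.map_cons, List.cons.injEq, add_assoc, Nat.reduceAdd]
  refine ⟨c1, by omega, h.crossesInColumn_three hm, ?_⟩
  rw [show r + 4 = r + 3 + 1 by omega, ← List.Ico.map_add, List.map_map]
  refine List.map_congr_left fun k hk => ?_
  rw [Function.comp_apply, add_comm 1 k]
  exact h.crossesInColumn_succ (List.Ico.mem.1 hk).1

lemma labelOf_eq_append {m r : ℕ} {T : Finset (ℕ × ℕ)} (h1 : corner m T ≤ r) (h2 : r + 2 ≤ m) :
    labelOf m T = (List.Ico (corner m T + 1) (r + 1)).map (crossesInColumn T) ++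
      crossesInColumn T (r + 1) :: (List.Ico (r + 2) m).map (crossesInColumn T) := by
  rw [labelOf, ← List.map_cons, ← List.map_append, ← List.Ico.eq_cons (by omega),
    List.Ico.append_consecutive (by omega) (by omega)]

lemma IsSite.labelStep {m r j : ℕ} {S : Finset (ℕ × ℕ)} (h : IsSite m r j S) (hm : 5 ≤ m) :
    LabelStep (labelOf m (S.filter (Nontriv m)))
      (labelOf (m + 1) ((splitAt m r j S).filter (Nontriv (m + 1)))) := by
  have c3 := h.full.card_siteRows hm h.two_le h.add_two_le
  have c4 := card_filter_le_add_card_filter_lt (siteRows r S) j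
  have c5 : 0 < ((siteRows r S).filter (· ≤ j)).card :=
    Finset.card_pos.2 ⟨j, Finset.mem_filter.2 ⟨mem_siteRows.2 ⟨h.lt, h.mem⟩, le_rfl⟩⟩
  have h2 := h.add_two_le
  rw [labelOf_eq_append h.corner_le h2]
  rcases h2.eq_or_lt with hr | hr
  · rw [h.labelOf_splitAt_last hm hr, List.Ico.eq_nil_of_le hr.ge, List.map_nil]
    rw [if_pos hr] at c3
    exact LabelStep.last _ _ _ (by omega)
  · rw [h.labelOf_splitAt_inner hm hr, List.Ico.eq_cons (n := r + 2) hr, List.map_cons]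
    rw [if_neg hr.ne] at c3
    exact LabelStep.inner _ _ _ _ _ (by omega)

/-- The length of the label determines the vertex that was split, and its first entry the place of
the splitting. -/
lemma IsSite.eq_of_labelOf_eq {m r r' j j' : ℕ} {S : Finset (ℕ × ℕ)} (h : IsSite m r j S)
    (h' : IsSite m r' j' S) (hm : 5 ≤ m)
    (hl : labelOf (m + 1) ((splitAt m r j S).filter (Nontriv (m + 1))) =
      labelOf (m + 1) ((splitAt m r' j' S).filter (Nontriv (m + 1)))) : r = r' ∧ j = j' := by
  have h2 := h.add_two_le
  have h2' := h'.add_two_le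
  rw [labelOf, labelOf, h.corner_splitAt hm, h'.corner_splitAt hm] at hl
  have hlen := congrArg List.length hl
  rw [List.length_map, List.length_map, List.Ico.length, List.Ico.length] at hlen
  obtain rfl : r = r' := by omega
  rw [List.Ico.eq_cons (by omega), List.map_cons, List.map_cons, List.cons.injEq,
    h.crossesInColumn_one, h'.crossesInColumn_one] at hl
  exact ⟨rfl, card_filter_lt_injOn _ (mem_siteRows.2 ⟨h.lt, h.mem⟩)
    (mem_siteRows.2 ⟨h'.lt, h'.mem⟩) hl.1⟩

lemma IsFullTriangulation.exists_isSite {m r i : ℕ} {S : Finset (ℕ × ℕ)}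
    (h : IsFullTriangulation m S) (hr : corner m (S.filter (Nontriv m)) ≤ r) (h2 : r + 2 ≤ m)
    (hi : i < (siteRows r S).card) :
    ∃ j, IsSite m r j S ∧ ((siteRows r S).filter (j < ·)).card = i := by
  obtain ⟨j, hj, hji⟩ := exists_card_filter_lt_eq _ hi
  rw [mem_siteRows] at hj
  exact ⟨j, ⟨h, h.two_le_corner.trans hr, h2,
    fun a b hab hlen => (h.row_le_corner hab hlen).trans hr, hj.1, hj.2⟩, hji⟩

lemma IsFullTriangulation.exists_isSite_of_labelStep {m : ℕ} {S : Finset (ℕ × ℕ)}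
    (h : IsFullTriangulation m S) (hm : 5 ≤ m) {e : List ℕ}
    (he : LabelStep (labelOf m (S.filter (Nontriv m))) e) :
    ∃ r j, IsSite m r j S ∧
      labelOf (m + 1) ((splitAt m r j S).filter (Nontriv (m + 1))) = e := by
  have h2c := h.two_le_corner
  generalize hL : labelOf m (S.filter (Nontriv m)) = L at he
  have hlen := congrArg List.length hL
  rw [labelOf, List.length_map, List.Ico.length] at hlen
  have hpre : ∀ pre : List ℕ, ((List.Ico (corner m (S.filter (Nontriv m)) + 1)
      (corner m (S.filter (Nontriv m)) + pre.length + 1)).map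
        (crossesInColumn (S.filter (Nontriv m)))).length = pre.length := by
    intro pre
    rw [List.length_map, List.Ico.length]
    omega
  cases he with
  | inner pre a b post i hi =>
    simp only [List.length_append, List.length_cons] at hlen
    rw [labelOf_eq_append (r := corner m (S.filter (Nontriv m)) + pre.length) (by omega)
      (by omega)] at hL
    set r := corner m (S.filter (Nontriv m)) + pre.length with hr
    obtain ⟨-, hL⟩ := List.append_inj hL (hpre pre)
    rw [List.Ico.eq_cons (by omega), List.map_cons, List.cons.injEq, List.cons.injEq] at hL
    obtain ⟨rfl, rfl, rfl⟩ := hL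
    have c3 := h.card_siteRows (r := r) hm (by omega) (by omega)
    obtain ⟨j, hj, rfl⟩ := h.exists_isSite (r := r) (i := i) (by omega) (by omega) (by omega)
    exact ⟨r, j, hj, hj.labelOf_splitAt_inner hm (by omega)⟩
  | last pre a i hi =>
    simp only [List.length_append, List.length_cons, List.length_nil] at hlen
    rw [labelOf_eq_append (r := corner m (S.filter (Nontriv m)) + pre.length) (by omega)
      (by omega)] at hL
    set r := corner m (S.filter (Nontriv m)) + pre.length with hr
    obtain ⟨-, hL⟩ := List.append_inj hL (hpre pre)
    obtain ⟨rfl, -⟩ := List.cons.inj hL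
    have c3 := h.card_siteRows (r := r) hm (by omega) (by omega)
    rw [if_pos (by omega)] at c3
    obtain ⟨j, hj, rfl⟩ := h.exists_isSite (r := r) (i := i) (by omega) (by omega) (by omega)
    exact ⟨r, j, hj, hj.labelOf_splitAt_last hm (by omega)⟩

/-! ### The children of a `2`-triangulation -/

/-- Every `2`-triangulation arises by splitting a vertex of its parent. -/
lemma IsTriangulation.exists_isSite {m : ℕ} {T : Finset (ℕ × ℕ)} (h : IsTriangulation (m + 1) T)
    (hm : 5 ≤ m) : ∃ r j S, IsSite m r j S ∧ S.filter (Nontriv m) = parent (m + 1) T ∧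
      T = (splitAt m r j S).filter (Nontriv (m + 1)) := by
  obtain ⟨S, hS, rfl⟩ := h
  have hc := hS.hasCorner (by omega)
  obtain ⟨j, hj⟩ := hc.exists_isApex
  refine ⟨_, j, _, hc.isSite hj, (hc.parent_eq hm).symm, ?_⟩
  rw [hc.splitAt_merge hj]

lemma IsTriangulation.parent {m : ℕ} {T : Finset (ℕ × ℕ)} (h : IsTriangulation (m + 1) T)
    (hm : 5 ≤ m) : IsTriangulation m (parent (m + 1) T) := by
  obtain ⟨r, j, S, hs, hp, -⟩ := h.exists_isSite hm
  exact ⟨S, hs.full, hp.symm⟩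

lemma IsTriangulation.labelStep {m : ℕ} {T : Finset (ℕ × ℕ)} (h : IsTriangulation (m + 1) T)
    (hm : 5 ≤ m) : LabelStep (labelOf m (TwoTri.parent (m + 1) T)) (labelOf (m + 1) T) := by
  obtain ⟨r, j, S, hs, hp, rfl⟩ := h.exists_isSite hm
  rw [← hp]
  exact hs.labelStep hm

lemma IsTriangulation.eq_of_parent_eq {m : ℕ} {T U : Finset (ℕ × ℕ)}
    (hT : IsTriangulation (m + 1) T) (hU : IsTriangulation (m + 1) U) (hm : 5 ≤ m)
    (hp : TwoTri.parent (m + 1) T = TwoTri.parent (m + 1) U)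
    (hl : labelOf (m + 1) T = labelOf (m + 1) U) : T = U := by
  obtain ⟨r, j, S, hs, hp1, rfl⟩ := hT.exists_isSite hm
  obtain ⟨r', j', S', hs', hp2, rfl⟩ := hU.exists_isSite hm
  obtain rfl := hs.full.eq_of_filter_eq hs'.full (by rw [hp1, hp2, hp])
  obtain ⟨rfl, rfl⟩ := hs.eq_of_labelOf_eq hs' hm hl
  rfl

lemma IsTriangulation.exists_child {m : ℕ} {T : Finset (ℕ × ℕ)} (h : IsTriangulation m T)
    (hm : 5 ≤ m) {e : List ℕ} (he : LabelStep (labelOf m T) e) :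
    ∃ U, IsTriangulation (m + 1) U ∧ TwoTri.parent (m + 1) U = T ∧ labelOf (m + 1) U = e := by
  obtain ⟨S, hS, rfl⟩ := h
  obtain ⟨r, j, hs, rfl⟩ := hS.exists_isSite_of_labelStep hm he
  exact ⟨_, ⟨_, hs.hasCorner.full, rfl⟩, hs.parent_splitAt hm, rfl⟩

lemma IsTriangulation.eq_empty {T : Finset (ℕ × ℕ)} (h : IsTriangulation 5 T) : T = ∅ := by
  obtain ⟨S, hS, rfl⟩ := h
  rw [Finset.filter_eq_empty_iff]
  rintro ⟨a, b⟩ hd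
  rw [nontriv_iff (hS.1.1 hd)]
  omega

/-! ### The isomorphism of labelled trees -/

/-- The labels met on the way from the `2`-triangulation `T` of the `(ℓ + 5)`-gon up to the
root. -/
def labelPath : ℕ → Finset (ℕ × ℕ) → List (List ℕ)
  | 0, T => [labelOf 5 T]
  | ℓ + 1, T => labelOf (ℓ + 6) T :: labelPath ℓ (parent (ℓ + 6) T)

lemma length_labelPath (ℓ : ℕ) (T : Finset (ℕ × ℕ)) : (labelPath ℓ T).length = ℓ + 1 := by
  induction ℓ generalizing T with
  | zero => rfl
  | succ ℓ ih => rw [labelPath, List.length_cons, ih]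

lemma labelPath_eq_cons (ℓ : ℕ) (T : Finset (ℕ × ℕ)) :
    ∃ q, labelPath ℓ T = labelOf (ℓ + 5) T :: q := by
  cases ℓ with
  | zero => exact ⟨[], rfl⟩
  | succ ℓ => exact ⟨_, rfl⟩

lemma labelPath_ne_nil (ℓ : ℕ) (T : Finset (ℕ × ℕ)) : labelPath ℓ T ≠ [] := by
  obtain ⟨q, hq⟩ := labelPath_eq_cons ℓ T
  simp [hq]

lemma labelOf_pentagon : labelOf 5 ∅ = [0, 0] := by
  decide

lemma getLast_labelPath (ℓ : ℕ) (T : Finset (ℕ × ℕ)) (h : IsTriangulation (ℓ + 5) T) :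
    (labelPath ℓ T).getLast (labelPath_ne_nil ℓ T) = [0, 0] := by
  induction ℓ generalizing T with
  | zero =>
    obtain rfl := h.eq_empty
    exact labelOf_pentagon
  | succ ℓ ih =>
    simp only [labelPath]
    rw [List.getLast_cons (labelPath_ne_nil _ _)]
    exact ih _ (h.parent (m := ℓ + 5) (by omega))

lemma isChain_labelPath (ℓ : ℕ) (T : Finset (ℕ × ℕ)) (h : IsTriangulation (ℓ + 5) T) :
    (labelPath ℓ T).IsChain fun e d => LabelStep d e := by
  induction ℓ generalizing T with
  | zero => exact List.isChain_singleton _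
  | succ ℓ ih =>
    have ih := ih _ (h.parent (m := ℓ + 5) (by omega))
    rw [labelPath]
    obtain ⟨q, hq⟩ := labelPath_eq_cons ℓ (parent (ℓ + 6) T)
    rw [hq] at ih ⊢
    exact List.isChain_cons_cons.2 ⟨h.labelStep (m := ℓ + 5) (by omega), ih⟩

lemma labelPath_injective (ℓ : ℕ) (T U : Finset (ℕ × ℕ)) (hT : IsTriangulation (ℓ + 5) T)
    (hU : IsTriangulation (ℓ + 5) U) (h : labelPath ℓ T = labelPath ℓ U) : T = U := by
  induction ℓ generalizing T U with
  | zero => rw [hT.eq_empty, hU.eq_empty]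
  | succ ℓ ih =>
    obtain ⟨h1, h2⟩ := List.cons.inj h
    have hm : 5 ≤ ℓ + 5 := by omega
    exact hT.eq_of_parent_eq (m := ℓ + 5) hU hm (ih _ _ (hT.parent hm) (hU.parent hm) h2) h1

lemma exists_labelPath_eq (p : List (List ℕ)) (hne : p ≠ []) (hroot : p.getLast hne = [0, 0])
    (hstep : p.IsChain fun e d => LabelStep d e) :
    ∃ ℓ T, IsTriangulation (ℓ + 5) T ∧ labelPath ℓ T = p := by
  induction p with
  | nil => exact absurd rfl hne
  | cons e q ih =>
    cases q with
    | nil =>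
      refine ⟨0, ∅, isTriangulation_pentagon, ?_⟩
      rw [List.getLast_singleton] at hroot
      rw [labelPath, labelOf_pentagon, hroot]
    | cons d q =>
      rw [List.getLast_cons (List.cons_ne_nil _ _)] at hroot
      obtain ⟨hde, hstep⟩ := List.isChain_cons_cons.1 hstep
      obtain ⟨ℓ, T, hT, hp⟩ := ih (List.cons_ne_nil _ _) hroot hstep
      obtain ⟨q', hq'⟩ := labelPath_eq_cons ℓ T
      obtain ⟨rfl, -⟩ := List.cons.inj (hq'.symm.trans hp)
      obtain ⟨U, hU, hUT, hUe⟩ := hT.exists_child (by omega) hde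
      refine ⟨ℓ + 1, U, hU, ?_⟩
      rw [labelPath]
      exact congrArg₂ List.cons hUe (hUT ▸ hp)

/-- A `2`-triangulation is sent to the sequence of labels on its way to the root. -/
def TriNode.toRuleNode (x : TriNode) : RuleNode where
  path := labelPath x.level x.diagram
  ne_nil := labelPath_ne_nil _ _
  root_eq := getLast_labelPath _ _ x.isTriangulation
  step := isChain_labelPath _ _ x.isTriangulation

lemma TriNode.label_toRuleNode (x : TriNode) : x.toRuleNode.label = x.label := by
  obtain ⟨q, hq⟩ := labelPath_eq_cons x.level x.diagram
  simp only [RuleNode.label, toRuleNode, hq, List.head_cons, TriNode.label]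

lemma TriNode.toRuleNode_bijective : Function.Bijective TriNode.toRuleNode := by
  constructor
  · rintro ⟨ℓ, T, hT⟩ ⟨ℓ', U, hU⟩ h
    have hp : labelPath ℓ T = labelPath ℓ' U := congrArg RuleNode.path h
    have hlen := congrArg List.length hp
    rw [length_labelPath, length_labelPath] at hlen
    obtain rfl : ℓ = ℓ' := by omega
    obtain rfl := labelPath_injective _ _ _ hT hU hp
    rfl
  · rintro ⟨p, hne, hroot, hstep⟩
    obtain ⟨ℓ, T, hT, rfl⟩ := exists_labelPath_eq p hne hroot hstep
    exact ⟨⟨ℓ, T, hT⟩, rfl⟩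

lemma TriNode.isParent_toRuleNode_iff (x y : TriNode) :
    x.toRuleNode.IsParent y.toRuleNode ↔ x.IsParent y := by
  obtain ⟨ℓ, T, hT⟩ := x
  obtain ⟨ℓ', U, hU⟩ := y
  rw [RuleNode.IsParent, TriNode.label_toRuleNode]
  change labelPath ℓ' U = labelOf (ℓ' + 5) U :: labelPath ℓ T ↔
    ℓ' = ℓ + 1 ∧ parent (ℓ' + 5) U = T
  constructor
  · intro h
    have hlen := congrArg List.length h
    rw [List.length_cons, length_labelPath, length_labelPath] at hlen
    obtain rfl : ℓ' = ℓ + 1 := by omega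
    exact ⟨rfl, labelPath_injective _ _ _ (hU.parent (m := ℓ + 5) (by omega)) hT
      (List.cons.inj h).2⟩
  · rintro ⟨rfl, rfl⟩
    rfl

end TwoTri

theorem mainTheorem2 :
    (∀ n : ℕ, 6 ≤ n → ∀ T : Finset (ℕ × ℕ), TwoTri.IsTriangulation n T →
      TwoTri.IsTriangulation (n - 1) (TwoTri.parent n T)) ∧
    ∃ φ : TwoTri.TriNode.IsParent ≃r TwoTri.RuleNode.IsParent,
      φ TwoTri.TriNode.root = TwoTri.RuleNode.root ∧
      ∀ x : TwoTri.TriNode, (φ x).label = x.label := by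
  refine ⟨fun n hn T hT => ?_, ⟨Equiv.ofBijective _ TwoTri.TriNode.toRuleNode_bijective,
    TwoTri.TriNode.isParent_toRuleNode_iff _ _⟩, ?_, TwoTri.TriNode.label_toRuleNode⟩
  · obtain ⟨m, rfl⟩ : ∃ m, n = m + 1 := ⟨n - 1, by omega⟩
    exact hT.parent (by omega)
  · change TwoTri.TriNode.root.toRuleNode = TwoTri.RuleNode.root
    simp only [TwoTri.TriNode.toRuleNode, TwoTri.TriNode.root, TwoTri.labelPath,
      TwoTri.labelOf_pentagon, TwoTri.RuleNode.root]
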